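/- Let $d,K\ge 1$ be integers and let $X_1,\dots,X_K$ be independent random Hermitian matrices in $\mathbb{C}^{d\times d}$, defined on a common probability space. Write $\lambda_{\max}(A)$ for the largest eigenvalue of a Hermitian matrix $A$, and take expectations of random matrices entrywise. Then for every $\epsilon>0$, $$\mathbb{P}\Big\{\lambda_{\max}\Big(\sum_{k=1}^K X_k\Big)\le \epsilon\Big\}\;\le\;\inf_{\theta>0}\,\exp\Big(\theta\epsilon+K\cdot\log\lambda_{\max}\Big(\frac1K\sum_{k=1}^K\mathbb{E}\,e^{-\theta X_k}\Big)\Big),$$ where the expression under the infimum is read as $+\infty$ for those $\theta>0$ for which some $e^{-\theta X_k}$ is not integrable. -/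

import Mathlib

open MeasureTheory ProbabilityTheory

/-- The largest eigenvalue of a matrix with real spectrum, as the supremum of the set of its real
eigenvalues; for Hermitian matrices of positive size see `lambdaMax_isGreatest`. -/
noncomputable def lambdaMax {d : ℕ} (A : Matrix (Fin d) (Fin d) ℂ) : ℝ :=
  sSup {r : ℝ | Module.End.HasEigenvalue (Matrix.toLin' A) (r : ℂ)}

/-- For a Hermitian matrix of positive size the supremum in `lambdaMax` is attained: it is the
largest eigenvalue. -/
theorem lambdaMax_isGreatest {d : ℕ} (hd : 0 < d) {A : Matrix (Fin d) (Fin d) ℂ}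
    (hA : A.IsHermitian) :
    IsGreatest {r : ℝ | Module.End.HasEigenvalue (Matrix.toLin' A) (r : ℂ)} (lambdaMax A) := by
  have hset : {r : ℝ | Module.End.HasEigenvalue (Matrix.toLin' A) (r : ℂ)}
      = Set.range hA.eigenvalues := by
    rw [← hA.spectrum_real_eq_range_eigenvalues]
    ext r
    rw [Set.mem_ofPred_eq, Module.End.hasEigenvalue_iff_mem_spectrum, Matrix.spectrum_toLin',
      ← spectrum.algebraMap_mem_iff ℂ]
    rfl
  have hne : (Set.range hA.eigenvalues).Nonempty := ⟨_, ⟨⟨0, hd⟩, rfl⟩⟩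
  rw [lambdaMax, hset]
  exact ⟨hne.csSup_mem (Set.finite_range _),
    fun x hx => le_csSup (Set.finite_range _).bddAbove hx⟩

/-- Complex matrices carry the product σ-algebra of their entries. -/
noncomputable instance matrixMeasurableSpace {d : ℕ} : MeasurableSpace (Matrix (Fin d) (Fin d) ℂ) :=
  MeasurableSpace.pi (X := fun _ : Fin d => Fin d → ℂ)

/-- This σ-algebra is the Borel σ-algebra. -/
instance matrixBorelSpace {d : ℕ} : BorelSpace (Matrix (Fin d) (Fin d) ℂ) :=
  Pi.borelSpace (X := fun _ : Fin d => Fin d → ℂ)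

/-- A random matrix is integrable when each of its entries is. -/
def MatrixIntegrable {Ω : Type*} [MeasurableSpace Ω] {d : ℕ}
    (Y : Ω → Matrix (Fin d) (Fin d) ℂ) (μ : Measure Ω) : Prop :=
  ∀ i j, Integrable (fun ω => Y ω i j) μ

/-- The (entrywise) expectation of a random matrix. -/
noncomputable def matrixExpectation {Ω : Type*} [MeasurableSpace Ω] {d : ℕ}
    (Y : Ω → Matrix (Fin d) (Fin d) ℂ) (μ : Measure Ω) : Matrix (Fin d) (Fin d) ℂ :=
  Matrix.of fun i j => ∫ ω, Y ω i j ∂μ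

/-! The bound reduces to a scalar Chernoff argument through the normalized trace τ = Re tr / d,
which is linear and at most `lambdaMax` on Hermitian matrices. The event forces τ(∑ X_k) ≤ ε, so
Markov and independence bound its probability by exp(θε) ∏ E exp(-θ τ(X_k)). Jensen over the
eigenvalues (`exp_trace_re_div_le`) bounds each factor by τ(E exp(-θ X_k)). AM-GM
(`prod_le_mean_pow`) and linearity bound the product of these by τ(M)^K, where M is the mean of the
expectations, and τ(M) ≤ `lambdaMax M`. No trace inequality for noncommuting matrices is needed. -/

/-- The normalized trace of a Hermitian matrix is at most its largest eigenvalue. -/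
theorem trace_re_div_le_lambdaMax {d : ℕ} (hd : 0 < d) {A : Matrix (Fin d) (Fin d) ℂ}
    (hA : A.IsHermitian) : A.trace.re / d ≤ lambdaMax A := by
  have hle (i : Fin d) : hA.eigenvalues i ≤ lambdaMax A := by
    refine (lambdaMax_isGreatest hd hA).2 ?_
    rw [Set.mem_ofPred_eq, Module.End.hasEigenvalue_iff_mem_spectrum, Matrix.spectrum_toLin']
    exact (spectrum.algebraMap_mem_iff ℂ).2 (hA.eigenvalues_mem_spectrum_real i)
  rw [div_le_iff₀ (by exact_mod_cast hd), hA.trace_eq_sum_eigenvalues, Complex.re_sum]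
  calc ∑ i, ((hA.eigenvalues i : ℂ)).re ≤ ∑ _i : Fin d, lambdaMax A :=
        Finset.sum_le_sum fun i _ => hle i
    _ = lambdaMax A * d := by simp [mul_comm]

/-- The trace of the exponential of a Hermitian matrix is the sum of the exponentials of its
eigenvalues. -/
theorem trace_exp_eq_sum_exp_eigenvalues {n : Type*} [Fintype n] [DecidableEq n]
    {A : Matrix n n ℂ} (hA : A.IsHermitian) :
    (NormedSpace.exp A).trace = ∑ i, (Real.exp (hA.eigenvalues i) : ℂ) := by
  have key : NormedSpace.exp A =
      (Unitary.toUnits hA.eigenvectorUnitary : (Matrix n n ℂ)ˣ) *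
        NormedSpace.exp (Matrix.diagonal ((RCLike.ofReal : ℝ → ℂ) ∘ hA.eigenvalues)) *
        ((Unitary.toUnits hA.eigenvectorUnitary)⁻¹ : (Matrix n n ℂ)ˣ) := by
    rw [← Matrix.exp_units_conj]
    congr 1
    conv_lhs => rw [hA.spectral_theorem, Unitary.conjStarAlgAut_apply]
    rfl
  rw [key, Matrix.trace_mul_comm, ← mul_assoc, Units.inv_mul, one_mul, Matrix.exp_diagonal,
    Matrix.trace_diagonal]
  refine Finset.sum_congr rfl fun i _ => ?_
  rw [Pi.coe_exp, Function.comp_apply, ← Complex.exp_eq_exp_ℂ]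
  exact (Complex.ofReal_exp _).symm

/-- Jensen's inequality for the normalized trace of the exponential. -/
theorem exp_trace_re_div_le {d : ℕ} (hd : 0 < d) {A : Matrix (Fin d) (Fin d) ℂ}
    (hA : A.IsHermitian) :
    Real.exp (A.trace.re / d) ≤ (NormedSpace.exp A).trace.re / d := by
  have hd' : (d : ℝ) ≠ 0 := by exact_mod_cast hd.ne'
  have h := convexOn_exp.map_sum_le (t := Finset.univ) (w := fun _ : Fin d => (d : ℝ)⁻¹)
    (p := hA.eigenvalues) (fun _ _ => by positivity) (by simp [hd']) (fun _ _ => Set.mem_univ _)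
  rw [trace_exp_eq_sum_exp_eigenvalues hA, hA.trace_eq_sum_eigenvalues, Complex.re_sum,
    Complex.re_sum, div_eq_inv_mul, div_eq_inv_mul, Finset.mul_sum, Finset.mul_sum]
  exact h

theorem MatrixIntegrable.integrable_trace {Ω : Type*} [MeasurableSpace Ω] {μ : Measure Ω} {d : ℕ}
    {Y : Ω → Matrix (Fin d) (Fin d) ℂ} (hY : MatrixIntegrable Y μ) :
    Integrable (fun ω => (Y ω).trace) μ :=
  integrable_finsetSum _ fun i _ => hY i i

theorem MatrixIntegrable.trace_matrixExpectation {Ω : Type*} [MeasurableSpace Ω] {μ : Measure Ω}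
    {d : ℕ} {Y : Ω → Matrix (Fin d) (Fin d) ℂ} (hY : MatrixIntegrable Y μ) :
    (matrixExpectation Y μ).trace.re = ∫ ω, (Y ω).trace.re ∂μ := by
  have h : (matrixExpectation Y μ).trace = ∫ ω, (Y ω).trace ∂μ :=
    (integral_finsetSum _ fun i _ => hY i i).symm
  rw [h]
  exact (integral_re hY.integrable_trace).symm

theorem isHermitian_matrixExpectation {Ω : Type*} [MeasurableSpace Ω] {μ : Measure Ω} {d : ℕ}
    {Y : Ω → Matrix (Fin d) (Fin d) ℂ} (hY : ∀ ω, (Y ω).IsHermitian) :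
    (matrixExpectation Y μ).IsHermitian := by
  ext i j
  change (starRingEnd ℂ) (∫ ω, Y ω j i ∂μ) = ∫ ω, Y ω i j ∂μ
  rw [← integral_conj]
  exact integral_congr_ae (ae_of_all _ fun ω => (hY ω).apply i j)

/-- A random Hermitian matrix with integrable exponential satisfies the scalar Jensen bound for the
normalized trace. -/
theorem integral_exp_trace_div_le {Ω : Type*} [MeasurableSpace Ω] {μ : Measure Ω}
    {d : ℕ} (hd : 0 < d) {Y : Ω → Matrix (Fin d) (Fin d) ℂ} (hmeas : Measurable Y)
    (hY : ∀ ω, (Y ω).IsHermitian) (hint : MatrixIntegrable (fun ω => NormedSpace.exp (Y ω)) μ) :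
    Integrable (fun ω => Real.exp ((Y ω).trace.re / d)) μ ∧
      ∫ ω, Real.exp ((Y ω).trace.re / d) ∂μ ≤
        (matrixExpectation (fun ω => NormedSpace.exp (Y ω)) μ).trace.re / d := by
  have hmt : Measurable fun ω => Real.exp ((Y ω).trace.re / d) := by
    have : Measurable fun A : Matrix (Fin d) (Fin d) ℂ => Real.exp (A.trace.re / d) :=
      Continuous.measurable (by fun_prop)
    exact this.comp hmeas
  have hexp : Integrable (fun ω => (NormedSpace.exp (Y ω)).trace.re / d) μ :=
    hint.integrable_trace.re.div_const _
  have hle (ω : Ω) := exp_trace_re_div_le hd (hY ω)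
  -- Jensen also supplies the dominating function.
  have hi : Integrable (fun ω => Real.exp ((Y ω).trace.re / d)) μ :=
    hexp.mono' hmt.aestronglyMeasurable (ae_of_all _ fun ω => by
      rw [Real.norm_eq_abs, Real.abs_exp]; exact hle ω)
  refine ⟨hi, (integral_mono hi hexp hle).trans_eq ?_⟩
  rw [hint.trace_matrixExpectation, integral_div]

/-- The inequality of arithmetic and geometric means, without roots. -/
theorem prod_le_mean_pow {K : ℕ} (hK : 0 < K) (v : Fin K → ℝ) (hv : ∀ k, 0 ≤ v k) :
    ∏ k, v k ≤ ((∑ k, v k) / K) ^ K := by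
  have h := Real.geom_mean_le_arith_mean Finset.univ (fun _ : Fin K => (1 : ℝ)) v
    (fun _ _ => zero_le_one) (by simpa using hK) (fun k _ => hv k)
  simp only [Real.rpow_one, one_mul, Finset.sum_const, Finset.card_univ, Fintype.card_fin,
    nsmul_eq_mul, mul_one] at h
  have hp : 0 ≤ ∏ k, v k := Finset.prod_nonneg fun k _ => hv k
  calc ∏ k, v k = ((∏ k, v k) ^ (K : ℝ)⁻¹) ^ K := (Real.rpow_inv_natCast_pow hp hK.ne').symm
    _ ≤ _ := pow_le_pow_left₀ (Real.rpow_nonneg hp _) h K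

theorem mainTheorem3 {Ω : Type*} [MeasurableSpace Ω] (μ : Measure Ω) [IsProbabilityMeasure μ]
    (d K : ℕ) (hd : 0 < d) (hK : 0 < K)
    (X : Fin K → Ω → Matrix (Fin d) (Fin d) ℂ)
    (hmeas : ∀ k, Measurable (X k))
    (hherm : ∀ k ω, (X k ω).IsHermitian)
    (hindep : iIndepFun X μ)
    (ε : ℝ) (hε : 0 < ε) :
    μ {ω | lambdaMax (∑ k, X k ω) ≤ ε} ≤
      ⨅ (θ : ℝ) (_ : 0 < θ)
        (_ : ∀ k, MatrixIntegrable (fun ω => NormedSpace.exp (-(θ : ℂ) • X k ω)) μ),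
        ENNReal.ofReal (Real.exp (θ * ε + K * Real.log (lambdaMax
          ((1 / (K : ℂ)) •
            ∑ k, matrixExpectation (fun ω => NormedSpace.exp (-(θ : ℂ) • X k ω)) μ)))) := by
  -- When integrability fails, the innermost infimum is over an empty family and equals ⊤.
  refine le_iInf fun θ => le_iInf fun hθ => le_iInf fun hint => ?_
  have hdR : (0 : ℝ) < d := by exact_mod_cast hd
  have hKR : (0 : ℝ) < K := by exact_mod_cast hK
  set E : Fin K → Matrix (Fin d) (Fin d) ℂ :=
    fun k => matrixExpectation (fun ω => NormedSpace.exp (-(θ : ℂ) • X k ω)) μ with hE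
  set M : Matrix (Fin d) (Fin d) ℂ := (1 / (K : ℂ)) • ∑ k, E k with hM
  have hYherm (k : Fin K) (ω : Ω) : (-(θ : ℂ) • X k ω).IsHermitian := by
    simp [Matrix.IsHermitian, Matrix.conjTranspose_smul, (hherm k ω).eq]
  have hscal : Continuous fun A : Matrix (Fin d) (Fin d) ℂ => -(θ : ℂ) • A :=
    continuous_const_smul _
  have hYmeas (k : Fin K) : Measurable fun ω => -(θ : ℂ) • X k ω :=
    hscal.measurable.comp (hmeas k)
  have hJ (k : Fin K) := integral_exp_trace_div_le hd (hYmeas k) (hYherm k) (hint k)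
  have hpos (k : Fin K) : 0 < ∫ ω, Real.exp ((-(θ : ℂ) • X k ω).trace.re / d) ∂μ :=
    integral_exp_pos (hJ k).1
  have hMherm : M.IsHermitian := by
    have hs : (∑ k, E k).IsHermitian := by
      rw [Matrix.IsHermitian, Matrix.conjTranspose_sum]
      exact Finset.sum_congr rfl fun k _ =>
        isHermitian_matrixExpectation fun ω => (hYherm k ω).exp
    simp [hM, Matrix.IsHermitian, Matrix.conjTranspose_smul, hs.eq]
  have htrM : (∑ k, (E k).trace.re / d) / K = M.trace.re / d := by
    have : (1 / (K : ℂ)) = ((1 / (K : ℝ) : ℝ) : ℂ) := by push_cast; rfl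
    rw [hM, Matrix.trace_smul, smul_eq_mul, this, Complex.re_ofReal_mul, Matrix.trace_sum,
      Complex.re_sum, ← Finset.sum_div]
    field_simp
  have hEpos (k : Fin K) : 0 < (E k).trace.re / d := (hpos k).trans_le (hJ k).2
  have : Nonempty (Fin K) := ⟨⟨0, hK⟩⟩
  have hmean : 0 < (∑ k, (E k).trace.re / d) / K :=
    div_pos (Finset.sum_pos (fun k _ => hEpos k) Finset.univ_nonempty) hKR
  have hmean_le : (∑ k, (E k).trace.re / d) / K ≤ lambdaMax M :=
    htrM.trans_le (trace_re_div_le_lambdaMax hd hMherm)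
  -- Positivity keeps `Real.log` away from its junk values, so exp (K log λ) really is λ ^ K at the
  -- end.
  have hlam : 0 < lambdaMax M := hmean.trans_le hmean_le
  have hprod : ∏ k, ∫ ω, Real.exp ((-(θ : ℂ) • X k ω).trace.re / d) ∂μ ≤ lambdaMax M ^ K :=
    calc _ ≤ ∏ k, (E k).trace.re / d :=
          Finset.prod_le_prod (fun k _ => (hpos k).le) fun k _ => (hJ k).2
      _ ≤ _ := prod_le_mean_pow hK _ fun k => (hEpos k).le
      _ ≤ _ := pow_le_pow_left₀ hmean.le hmean_le K
  -- With `ENNReal` values, independence factors the integral without any integrability of the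
  -- product.
  let g : Matrix (Fin d) (Fin d) ℂ → ENNReal :=
    fun A => ENNReal.ofReal (Real.exp ((-(θ : ℂ) • A).trace.re / d))
  have hg : Measurable g := ENNReal.measurable_ofReal.comp (Continuous.measurable (by fun_prop))
  have hgX : Measurable fun ω => ∏ k, g (X k ω) :=
    Finset.measurable_fun_prod _ fun k _ => hg.comp (hmeas k)
  calc μ {ω | lambdaMax (∑ k, X k ω) ≤ ε}
      ≤ ∫⁻ ω, ENNReal.ofReal (Real.exp (θ * ε)) * ∏ k, g (X k ω) ∂μ := by
        -- Markov's inequality: the integrand is at least 1 on the event.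
        refine meas_le_lintegral₀ (hgX.const_mul _).aemeasurable fun ω hω => ?_
        rw [← ENNReal.ofReal_prod_of_nonneg fun _ _ => (Real.exp_pos _).le,
          ← ENNReal.ofReal_mul (Real.exp_pos _).le, ← Real.exp_sum, ← Real.exp_add,
          ENNReal.one_le_ofReal, Real.one_le_exp_iff]
        have hsum : (∑ k, X k ω).IsHermitian := by
          rw [Matrix.IsHermitian, Matrix.conjTranspose_sum]
          exact Finset.sum_congr rfl fun k _ => hherm k ω
        have htr := (trace_re_div_le_lambdaMax hd hsum).trans hω
        have heq : ∑ k, (-(θ : ℂ) • X k ω).trace.re / d = -θ * ((∑ k, X k ω).trace.re / d) := by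
          rw [Matrix.trace_sum, Complex.re_sum, ← Finset.sum_div, mul_div_assoc', Finset.mul_sum]
          congr 1
          refine Finset.sum_congr rfl fun k _ => ?_
          rw [Matrix.trace_smul, smul_eq_mul, ← Complex.ofReal_neg, Complex.re_ofReal_mul]
        rw [heq]
        linarith [mul_le_mul_of_nonneg_left htr hθ.le]
    _ = ENNReal.ofReal (Real.exp (θ * ε)) * ∏ k, ∫⁻ ω, g (X k ω) ∂μ := by
        rw [lintegral_const_mul _ hgX]
        congr 1
        exact lintegral_prod_eq_prod_lintegral_of_indepFun Finset.univ (fun k ω => g (X k ω))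
          (hindep.comp (fun _ => g) fun _ => hg) fun k => hg.comp (hmeas k)
    _ = ENNReal.ofReal (Real.exp (θ * ε) *
          ∏ k, ∫ ω, Real.exp ((-(θ : ℂ) • X k ω).trace.re / d) ∂μ) := by
        rw [ENNReal.ofReal_mul (Real.exp_pos _).le,
          ENNReal.ofReal_prod_of_nonneg fun k _ => (hpos k).le]
        congr 1
        exact Finset.prod_congr rfl fun k _ => (ofReal_integral_eq_lintegral_ofReal (hJ k).1
          (ae_of_all _ fun ω => (Real.exp_pos _).le)).symm
    _ ≤ ENNReal.ofReal (Real.exp (θ * ε) * lambdaMax M ^ K) :=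
        ENNReal.ofReal_le_ofReal (mul_le_mul_of_nonneg_left hprod (Real.exp_pos _).le)
    _ = ENNReal.ofReal (Real.exp (θ * ε + K * Real.log (lambdaMax M))) := by
        rw [Real.exp_add, Real.exp_nat_mul, Real.exp_log hlam]
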